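/- Let $F$ be a field with $\operatorname{char}(F)\neq 2$ and let $A$ be a central simple $F$-algebra, i.e. a unital associative $F$-algebra, not necessarily finite-dimensional, that is simple as a ring and whose center is $F\cdot 1$. Write $[a,b]=ab-ba$ and let $[A,A]$ be the $F$-linear span of all commutators $[a,b]$ with $a,b\in A$. Suppose that $1\notin[A,A]$. Let $\mathcal D$ be the (associative, not necessarily unital) subalgebra of $\operatorname{End}_F(A)$ generated by all inner derivations $x\mapsto [a,x]$, $a\in A$. Then $\mathcal D$ acts densely on $[A,A]$: every $T\in\mathcal D$ maps $[A,A]$ into itself, and for all $n$, all $F$-linearly independent $x_1,\dots,x_n\in[A,A]$ and all $y_1,\dots,y_n\in[A,A]$ there exists $T\in\mathcal D$ such that $Tx_i=y_i$ for $i=1,\dots,n$. -/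

import Mathlib

/-- `[A, A]`: the `F`-linear span of all commutators `⁅a, b⁆ = a * b - b * a` in `A`. -/
def commutatorSpace (F A : Type*) [Field F] [Ring A] [Algebra F A] : Submodule F A :=
  Submodule.span F {z | ∃ a b : A, ⁅a, b⁆ = z}

/-- The associative, not necessarily unital, subalgebra of `End_F(A)` generated by all inner
derivations `x ↦ ⁅a, x⁆ = a * x - x * a` of `A`. In particular the identity operator is not adjoined. -/
def innerDerivationAlgebra (F A : Type*) [Field F] [Ring A] [Algebra F A] :
    NonUnitalSubalgebra F (Module.End F A) :=
  NonUnitalAlgebra.adjoin F {D | ∃ a : A, D = LinearMap.mulLeft F a - LinearMap.mulRight F a}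

/-- An algebra `𝒜` of linear operators on `V` acts densely on the subspace `X` of `V`:
`X` is invariant under `𝒜`, and every finite linearly independent family in `X` can be sent to any
family in `X` of the same size by an element of `𝒜`. -/
def ActsDenselyOn {F V : Type*} [Field F] [AddCommGroup V] [Module F V]
    (𝒜 : NonUnitalSubalgebra F (Module.End F V)) (X : Submodule F V) : Prop :=
  (∀ T ∈ 𝒜, ∀ x ∈ X, T x ∈ X) ∧
    ∀ (n : ℕ) (x y : Fin n → X), LinearIndependent F x →
      ∃ T ∈ 𝒜, ∀ i : Fin n, T (x i : V) = (y i : V)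

open Module

/-- **Jacobson density** for a set of operators on a vector space that acts irreducibly and has
only scalars in its centralizer. -/
theorem exists_mem_adjoin_eqOn_finset {F M : Type*} [Field F] [AddCommGroup M] [Module F M]
    [Nontrivial M] (G : Set (End F M))
    (hirr : ∀ V : Submodule F M, (∀ T ∈ G, ∀ v ∈ V, T v ∈ V) → V = ⊥ ∨ V = ⊤)
    (hcent : ∀ f : End F M, (∀ T ∈ G, ∀ v, f (T v) = T (f v)) → ∃ c : F, ∀ v, f v = c • v)
    (g : End F M) (s : Finset M) :
    ∃ T ∈ Algebra.adjoin F G, ∀ m ∈ s, T m = g m := by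
  let R := Algebra.adjoin F G
  have hsimple : IsSimpleModule R M := by
    rw [isSimpleModule_iff]
    have : Nontrivial (Submodule R M) := (Submodule.nontrivial_iff R).2 inferInstance
    refine ⟨fun N ↦ ?_⟩
    refine (hirr (N.restrictScalars F) fun T hT v hv ↦
      N.smul_mem (⟨T, Algebra.subset_adjoin hT⟩ : R) hv).imp (fun h ↦ ?_) (fun h ↦ ?_)
    · exact (Submodule.restrictScalars_eq_bot_iff F R M).1 h
    · exact (Submodule.restrictScalars_eq_top_iff F R M).1 h
  have hscalar (f : End R M) : ∃ c : F, ∀ v, f v = c • v :=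
    hcent (f.restrictScalars F) fun T hT v ↦
      f.map_smul (⟨T, Algebra.subset_adjoin hT⟩ : R) v
  let g' : End (End R M) M :=
    { toFun := g
      map_add' := g.map_add
      map_smul' := fun f v ↦ by
        obtain ⟨c, hc⟩ := hscalar f
        simp [hc] }
  obtain ⟨T, hT⟩ := jacobson_density (R := R) g' s
  exact ⟨T, T.2, fun m hm ↦ (hT m hm).symm⟩

section SimpleRing

variable {A : Type*} [Ring A] [IsSimpleRing A]

/-- A simple ring is prime. -/
theorem eq_zero_of_forall_mul_mul_eq_zero {x y : A} (h : ∀ c, x * c * y = 0) (hx : x ≠ 0) :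
    y = 0 := by
  let I : TwoSidedIdeal A := .mk' {z | ∀ c, z * c * y = 0} (by simp)
    (fun {u v} hu hv c ↦ by simp [add_mul, hu c, hv c])
    (fun {u} hu c ↦ by simp [hu c])
    (fun {u v} hv c ↦ by rw [mul_assoc u, mul_assoc u, hv c, mul_zero])
    (fun {u v} hu c ↦ by rw [mul_assoc u, hu])
  have h1 : (1 : A) ∈ I := IsSimpleRing.one_mem_of_ne_zero_mem I hx (by simpa [I] using h)
  have := (TwoSidedIdeal.mem_mk' _ _ _ _ _ _ _).1 h1 1
  simpa using this

/-- An additive subgroup of a simple ring that contains all `a * x * b` for some `x ≠ 0` is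
everything. -/
theorem AddSubgroup.eq_top_of_forall_mul_mul_mem (S : AddSubgroup A) {x : A} (hx : x ≠ 0)
    (h : ∀ a b, a * x * b ∈ S) : S = ⊤ := by
  let I : TwoSidedIdeal A := .mk' {z | ∀ a b, a * z * b ∈ S} (by simp [S.zero_mem])
    (fun {u v} hu hv a b ↦ by simpa [mul_add, add_mul] using S.add_mem (hu a b) (hv a b))
    (fun {u} hu a b ↦ by simpa using S.neg_mem (hu a b))
    (fun {u v} hv a b ↦ by simpa [mul_assoc] using hv (a * u) b)
    (fun {u v} hu a b ↦ by simpa [mul_assoc] using hu a (v * b))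
  have h1 : (1 : A) ∈ I := IsSimpleRing.one_mem_of_ne_zero_mem I hx (by simpa [I] using h)
  have h1' := (TwoSidedIdeal.mem_mk' _ _ _ _ _ _ _).1 h1
  exact (AddSubgroup.eq_top_iff' S).2 fun z ↦ by simpa using h1' z 1

end SimpleRing

section CentralSimple

variable {F A : Type*} [Field F] [Ring A] [Algebra F A]

theorem exists_eq_algebraMap_of_forall_commute [Algebra.IsCentral F A] {x : A}
    (h : ∀ a, a * x = x * a) : ∃ c : F, x = algebraMap F A c :=
  (Algebra.IsCentral.mem_center_iff F).1 (Subalgebra.mem_center_iff.2 h)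

/-- In a central simple algebra, `A ⊗ Aᵐᵒᵖ` acts faithfully on `A`: an identity
`∑ aᵢ * b * cᵢ = 0` in `b` persists when a linear functional is applied to the `cᵢ`. -/
theorem sum_smul_eq_zero_of_forall_sum_mul_mul_eq_zero [Algebra.IsCentral F A] [IsSimpleRing A]
    {ι : Type*} [Fintype ι] (a c : ι → A) (h : ∀ b, ∑ i, a i * b * c i = 0) (φ : A →ₗ[F] F) :
    ∑ i, φ (c i) • a i = 0 := by
  classical
  obtain ⟨T, hT, hTc⟩ := exists_mem_adjoin_eqOn_finset
    (Set.range (LinearMap.mulLeft F (A := A)) ∪ Set.range (LinearMap.mulRight F (A := A)))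
    (fun V hV ↦ by
      by_cases hV0 : V = ⊥
      · exact .inl hV0
      obtain ⟨v, hv, hv0⟩ := V.exists_mem_ne_zero_of_ne_bot hV0
      have := AddSubgroup.eq_top_of_forall_mul_mul_mem V.toAddSubgroup hv0 fun a b ↦
        hV (LinearMap.mulRight F b) (.inr ⟨b, rfl⟩) _
          (hV (LinearMap.mulLeft F a) (.inl ⟨a, rfl⟩) _ hv)
      exact .inr (Submodule.toAddSubgroup_injective this))
    (fun f hf ↦ by
      have hl (a v) : f (a * v) = a * f v := hf (LinearMap.mulLeft F a) (.inl ⟨a, rfl⟩) v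
      have hr (a v) : f (v * a) = f v * a := hf (LinearMap.mulRight F a) (.inr ⟨a, rfl⟩) v
      obtain ⟨k, hk⟩ := exists_eq_algebraMap_of_forall_commute (F := F) (x := f 1) fun a ↦ by
        rw [← hl, ← hr, mul_one, one_mul]
      exact ⟨k, fun v ↦ by rw [← one_mul v, hr, hk, one_mul, Algebra.smul_def]⟩)
    (φ.smulRight (1 : A)) (Finset.univ.image c)
  have key : ∀ b, ∑ i, a i * b * T (c i) = 0 := by
    have : ∀ c : ι → A, (∀ b, ∑ i, a i * b * c i = 0) → ∀ b, ∑ i, a i * b * T (c i) = 0 := by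
      clear hTc
      induction hT using Algebra.adjoin_induction with
      | mem T hT =>
        intro c hc b
        rcases hT with ⟨p, rfl⟩ | ⟨p, rfl⟩
        · simpa [mul_assoc] using hc (b * p)
        · simpa [mul_assoc, Finset.sum_mul] using congrArg (· * p) (hc b)
      | algebraMap k =>
        intro c hc b
        simpa [Algebra.algebraMap_eq_smul_one, ← Finset.smul_sum] using congrArg (k • ·) (hc b)
      | add S T _ _ hS hT =>
        intro c hc b
        simp [mul_add, Finset.sum_add_distrib, hS c hc b, hT c hc b]
      | mul S T _ _ hS hT =>
        intro c hc b
        exact hS _ (hT c hc) b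
    exact this c h
  simpa [hTc] using key 1

end CentralSimple

section Commutators

variable {F A : Type*} [Field F] [Ring A] [Algebra F A]

theorem lie_mem_commutatorSpace (a b : A) : ⁅a, b⁆ ∈ commutatorSpace F A :=
  Submodule.subset_span ⟨a, b, rfl⟩

theorem commutatorSpace_le {V : Submodule F A} (h : ∀ a b : A, ⁅a, b⁆ ∈ V) :
    commutatorSpace F A ≤ V :=
  Submodule.span_le.2 fun _ ⟨a, b, hab⟩ ↦ hab ▸ h a b

theorem lie_mem_innerDerivationAlgebra (a : A) :
    LinearMap.mulLeft F a - LinearMap.mulRight F a ∈ innerDerivationAlgebra F A :=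
  NonUnitalAlgebra.subset_adjoin F ⟨a, rfl⟩

theorem apply_mem_of_mem_innerDerivationAlgebra {V : Submodule F A}
    (hV : ∀ a : A, ∀ v ∈ V, ⁅a, v⁆ ∈ V) {T : End F A} (hT : T ∈ innerDerivationAlgebra F A) :
    ∀ v ∈ V, T v ∈ V := by
  induction hT using NonUnitalAlgebra.adjoin_induction with
  | mem T hT => obtain ⟨a, rfl⟩ := hT; exact hV a
  | add S T _ _ hS hT => exact fun v hv ↦ V.add_mem (hS v hv) (hT v hv)
  | zero => exact fun v _ ↦ V.zero_mem
  | mul S T _ _ hS hT => exact fun v hv ↦ hS _ (hT v hv)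
  | smul c T _ hT => exact fun v hv ↦ V.smul_mem c (hT v hv)

variable [Algebra.IsCentral F A]

theorem eq_zero_of_forall_lie_eq_zero (h1 : (1 : A) ∉ commutatorSpace F A) {x : A}
    (hx : x ∈ commutatorSpace F A) (h : ∀ a : A, ⁅a, x⁆ = 0) : x = 0 := by
  obtain ⟨c, rfl⟩ := exists_eq_algebraMap_of_forall_commute (F := F) (x := x) fun a ↦
    sub_eq_zero.1 (h a)
  by_cases hc : c = 0
  · simp [hc]
  · refine absurd ?_ h1
    rw [Algebra.algebraMap_eq_smul_one] at hx
    exact ((commutatorSpace F A).smul_mem_iff hc).1 hx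

variable [IsSimpleRing A]

/-- **Herstein's theorem** on the Lie ideals of a simple ring of characteristic not `2`, for Lie
ideals without nonzero central elements. -/
theorem eq_bot_or_commutatorSpace_le (hF : (2 : F) ≠ 0)
    (h1 : (1 : A) ∉ commutatorSpace F A) {V : Submodule F A} (hVle : V ≤ commutatorSpace F A)
    (hV : ∀ a : A, ∀ v ∈ V, ⁅a, v⁆ ∈ V) : V = ⊥ ∨ commutatorSpace F A ≤ V := by
  by_cases hcomm : ∀ u ∈ V, ∀ v ∈ V, ⁅u, v⁆ = 0
  · left
    refine (Submodule.eq_bot_iff V).2 fun v hv ↦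
      eq_zero_of_forall_lie_eq_zero h1 (hVle hv) fun a ↦ ?_
    have h2 (a b : A) : ⁅v, a⁆ * ⁅v, b⁆ = 0 := by
      have hab := hcomm v hv _ (hV (a * b) v hv)
      have ha := hcomm v hv _ (hV a v hv)
      have hb := hcomm v hv _ (hV b v hv)
      have : (2 : F) • (⁅v, a⁆ * ⁅v, b⁆) =
          -⁅v, ⁅a * b, v⁆⁆ + ⁅v, ⁅a, v⁆⁆ * b + a * ⁅v, ⁅b, v⁆⁆ := by
        rw [two_smul]; simp only [Ring.lie_def]; noncomm_ring
      rw [hab, ha, hb] at this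
      simpa [hF] using this
    by_contra hav
    have hav' : ⁅v, a⁆ ≠ 0 := fun h ↦ hav (by rw [Ring.lie_def] at h ⊢; rw [← neg_sub, h, neg_zero])
    refine hav' (eq_zero_of_forall_mul_mul_eq_zero (fun c ↦ ?_) hav')
    have e : ⁅v, a⁆ * c * ⁅v, a⁆ = ⁅v, a⁆ * ⁅v, c * a⁆ - ⁅v, a⁆ * ⁅v, c⁆ * a := by
      simp only [Ring.lie_def]; noncomm_ring
    rw [e, h2, h2]; simp
  · right
    push Not at hcomm
    obtain ⟨u, hu, v, hv, huv⟩ := hcomm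
    let S : AddSubgroup A :=
      { carrier := {x | ∀ a : A, ⁅a, x⁆ ∈ V}
        zero_mem' := fun a ↦ by simp [Ring.lie_def]
        add_mem' := fun {x y} hx hy a ↦ by
          have e : ⁅a, x + y⁆ = ⁅a, x⁆ + ⁅a, y⁆ := by simp only [Ring.lie_def]; noncomm_ring
          exact e ▸ V.add_mem (hx a) (hy a)
        neg_mem' := fun {x} hx a ↦ by
          have e : ⁅a, -x⁆ = -⁅a, x⁆ := by simp only [Ring.lie_def]; noncomm_ring
          exact e ▸ V.neg_mem (hx a) }
    have hVS {x} (hx : x ∈ V) : x ∈ S := fun a ↦ hV a x hx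
    have hmul {x y} (hx : x ∈ S) (hy : y ∈ S) : x * y ∈ S := fun a ↦ by
      have e : ⁅a, x * y⁆ = ⁅y * a, x⁆ + ⁅a * x, y⁆ := by
        simp only [Ring.lie_def]; noncomm_ring
      exact e ▸ V.add_mem (hx _) (hy _)
    have hlie (a) {x} (hx : x ∈ S) : ⁅a, x⁆ ∈ S := hVS (hx a)
    have hr (a : A) : ⁅u, v⁆ * a ∈ S := by
      have e : ⁅u, v⁆ * a = -⁅v * a, u⁆ + v * ⁅a, u⁆ := by
        simp only [Ring.lie_def]; noncomm_ring
      rw [e]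
      exact S.add_mem (S.neg_mem (hlie _ (hVS hu))) (hmul (hVS hv) (hlie _ (hVS hu)))
    have htop : S = ⊤ := S.eq_top_of_forall_mul_mul_mem huv fun b a ↦ by
      have e : b * ⁅u, v⁆ * a = ⁅b, ⁅u, v⁆ * a⁆ + ⁅u, v⁆ * (a * b) := by
        simp only [Ring.lie_def]; noncomm_ring
      rw [e]
      exact S.add_mem (hlie _ (hr a)) (hr _)
    exact commutatorSpace_le fun a b ↦ (htop ▸ AddSubgroup.mem_top b : b ∈ S) a

/-- An operator on `[A, A]` that commutes with all inner derivations of `A` is a scalar. -/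
theorem exists_eq_smul_of_forall_map_lie (hF : (2 : F) ≠ 0)
    (h1 : (1 : A) ∉ commutatorSpace F A) (f : End F (commutatorSpace F A))
    (hf : ∀ (a : A) (x : commutatorSpace F A),
      (f ⟨⁅a, (x : A)⁆, lie_mem_commutatorSpace a x⟩ : A) = ⁅a, (f x : A)⁆) :
    ∃ c : F, ∀ x, f x = c • x := by
  refine (LinearMap.exists_eq_smul_id_of_forall_notLinearIndependent (f := f) fun x ↦ ?_).imp
    fun c hc x ↦ by simp [hc]
  have hcomm (x u : commutatorSpace F A) : ⁅(x : A), (f u : A)⁆ = ⁅(f x : A), (u : A)⁆ := by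
    have e : (⟨⁅(x : A), (u : A)⁆, lie_mem_commutatorSpace _ _⟩ : commutatorSpace F A) =
        -⟨⁅(u : A), (x : A)⁆, lie_mem_commutatorSpace _ _⟩ := by
      ext
      simp [Ring.lie_def]
    rw [← hf, e, map_neg, Submodule.coe_neg, hf]
    simp [Ring.lie_def]
  have hb (b : A) : ⁅(x : A), ⁅b, (f (f x) : A)⁆⁆ = ⁅(f x : A), ⁅b, (f x : A)⁆⁆ := by
    rw [← hf, hcomm]
  have hspan : (f x : A) ∈ Submodule.span F {1, (x : A)} := by
    by_contra hx
    obtain ⟨φ, hφ, hker⟩ := Submodule.exists_le_ker_of_notMem hx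
    have hφ1 : φ 1 = 0 := hker (Submodule.subset_span (by simp))
    have hφx : φ x = 0 := hker (Submodule.subset_span (by simp))
    have := sum_smul_eq_zero_of_forall_sum_mul_mul_eq_zero (F := F)
      (a := ![(x : A), -(x * f (f x)), -1, (f (f x) : A), -(2 : F) • (f x : A), f x * f x, 1])
      (c := ![(f (f x) : A), 1, f (f x) * x, x, f x, 1, f x * f x])
      (fun b ↦ by
        have := sub_eq_zero.2 (hb b)
        simp only [Ring.lie_def] at this
        rw [← this]
        simp [Fin.sum_univ_succ, two_smul]
        noncomm_ring) φ
    simp [Fin.sum_univ_succ, hφ1, hφx] at this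
    refine hx (((Submodule.span F {1, (x : A)}).smul_mem_iff (mul_ne_zero hF hφ)).1 ?_)
    refine Submodule.mem_span_pair.2
      ⟨φ (f x * f x) - φ (f (f x) * x), φ (f (f x)), ?_⟩
    rw [← sub_eq_zero, ← this]
    module
  obtain ⟨p, q, hpq⟩ := Submodule.mem_span_pair.1 hspan
  have hp : p = 0 := by
    by_contra hp
    refine h1 (((commutatorSpace F A).smul_mem_iff hp).1 ?_)
    rw [eq_sub_of_add_eq hpq]
    exact Submodule.sub_mem _ (f x).2 (Submodule.smul_mem _ _ x.2)
  rw [LinearIndependent.pair_iff]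
  intro h
  refine one_ne_zero (neg_eq_zero.1 (h q (-1) ?_).2)
  ext
  simp [← hpq, hp]

/-- Every orbit of `innerDerivationAlgebra F A` on a nonzero element of `[A, A]` is `[A, A]`. -/
theorem exists_mem_innerDerivationAlgebra_apply_eq (hF : (2 : F) ≠ 0)
    (h1 : (1 : A) ∉ commutatorSpace F A) {w y : A} (hw : w ∈ commutatorSpace F A) (hw0 : w ≠ 0)
    (hy : y ∈ commutatorSpace F A) : ∃ T ∈ innerDerivationAlgebra F A, T w = y := by
  let V : Submodule F A :=
    (innerDerivationAlgebra F A).toSubmodule.map (LinearMap.applyₗ w)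
  have hVmem {z} : z ∈ V ↔ ∃ T ∈ innerDerivationAlgebra F A, T w = z := Iff.rfl
  refine hVmem.1 ((eq_bot_or_commutatorSpace_le hF h1 (V := V) ?_ ?_).resolve_left ?_ hy)
  · rintro _ ⟨T, hT, rfl⟩
    exact apply_mem_of_mem_innerDerivationAlgebra (fun a v _ ↦ lie_mem_commutatorSpace a v) hT w hw
  · rintro a _ ⟨T, hT, rfl⟩
    exact ⟨_, (innerDerivationAlgebra F A).mul_mem (lie_mem_innerDerivationAlgebra a) hT, rfl⟩
  · intro hbot
    refine hw0 (eq_zero_of_forall_lie_eq_zero h1 hw fun a ↦ ?_)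
    have : ⁅a, w⁆ ∈ V := ⟨_, lie_mem_innerDerivationAlgebra a, rfl⟩
    simpa [hbot] using this

/-- On finite subsets of `[A, A]`, the composition of an element of `innerDerivationAlgebra F A`
with any operator on `[A, A]` agrees with an element of `innerDerivationAlgebra F A`. -/
theorem exists_mem_innerDerivationAlgebra_apply_eq_comp (hF : (2 : F) ≠ 0)
    (h1 : (1 : A) ∉ commutatorSpace F A) {S : End F A} (hS : S ∈ innerDerivationAlgebra F A)
    (g : End F (commutatorSpace F A)) (s : Finset (commutatorSpace F A)) :
    ∃ T ∈ innerDerivationAlgebra F A, ∀ x ∈ s, T x = S (g x) := by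
  obtain hU | hU := subsingleton_or_nontrivial (commutatorSpace F A)
  · exact ⟨0, zero_mem _, fun x _ ↦ by simp [Subsingleton.elim (g x) 0]⟩
  let D (a : A) : End F (commutatorSpace F A) :=
    (LinearMap.mulLeft F a - LinearMap.mulRight F a).restrict
      fun v _ ↦ lie_mem_commutatorSpace a v
  obtain ⟨R, hR, hRg⟩ := exists_mem_adjoin_eqOn_finset (Set.range D)
    (fun V hV ↦ by
      refine (eq_bot_or_commutatorSpace_le hF h1 (V := V.map (commutatorSpace F A).subtype)
        (Submodule.map_subtype_le _ _) ?_).imp (fun h ↦ ?_) (fun h ↦ ?_)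
      · rintro a _ ⟨v, hv, rfl⟩
        exact ⟨D a v, hV _ ⟨a, rfl⟩ v hv, rfl⟩
      · exact Submodule.map_injective_of_injective (Submodule.subtype_injective _) (by simpa using h)
      · refine Submodule.eq_top_iff'.2 fun v ↦ ?_
        obtain ⟨u, hu, huv⟩ := h v.2
        exact (Subtype.ext huv : u = v) ▸ hu)
    (fun f hf ↦ exists_eq_smul_of_forall_map_lie hF h1 f fun a x ↦
      congrArg Subtype.val (hf _ ⟨a, rfl⟩ x))
    g s
  have key : ∀ S ∈ innerDerivationAlgebra F A, ∃ T ∈ innerDerivationAlgebra F A,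
      ∀ x : commutatorSpace F A, T x = S (R x) := by
    clear hRg
    induction hR using Algebra.adjoin_induction with
    | mem R hR =>
      obtain ⟨a, rfl⟩ := hR
      exact fun S hS ↦ ⟨_, mul_mem hS (lie_mem_innerDerivationAlgebra a), fun x ↦ rfl⟩
    | algebraMap c =>
      exact fun S hS ↦ ⟨c • S, SMulMemClass.smul_mem c hS, fun x ↦ by simp⟩
    | add P Q _ _ hP hQ =>
      intro S hS
      obtain ⟨P', hP', hPx⟩ := hP S hS
      obtain ⟨Q', hQ', hQx⟩ := hQ S hS
      exact ⟨P' + Q', add_mem hP' hQ', fun x ↦ by simp [hPx, hQx]⟩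
    | mul P Q _ _ hP hQ =>
      intro S hS
      obtain ⟨P', hP', hPx⟩ := hP S hS
      obtain ⟨Q', hQ', hQx⟩ := hQ P' hP'
      exact ⟨Q', hQ', fun x ↦ by rw [hQx, hPx]; rfl⟩
  obtain ⟨T, hT, hTx⟩ := key S hS
  exact ⟨T, hT, fun x hx ↦ by rw [hTx, hRg x hx]⟩

end Commutators
theorem corollary3p5 {F A : Type*} [Field F] [Ring A] [Algebra F A]
    [Algebra.IsCentral F A] [IsSimpleRing A]
    (hF : ringChar F ≠ 2)
    (h1 : (1 : A) ∉ commutatorSpace F A) :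
    ActsDenselyOn (innerDerivationAlgebra F A) (commutatorSpace F A) := by
  have hF2 : (2 : F) ≠ 0 := Ring.two_ne_zero hF
  classical
  refine ⟨fun T hT ↦ apply_mem_of_mem_innerDerivationAlgebra
    (fun a v _ ↦ lie_mem_commutatorSpace a v) hT, fun n x y hx ↦ ?_⟩
  obtain hU | hU := subsingleton_or_nontrivial (commutatorSpace F A)
  · exact ⟨0, zero_mem _, fun i ↦ by simp [Subsingleton.elim (y i) 0]⟩
  obtain ⟨w, hw⟩ := exists_ne (0 : commutatorSpace F A)
  choose S hSmem hS using fun i ↦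
    exists_mem_innerDerivationAlgebra_apply_eq hF2 h1 w.2 (by simpa using hw) (y i).2
  have hT (i : Fin n) : ∃ T ∈ innerDerivationAlgebra F A,
      ∀ j, T (x j) = if j = i then (y i : A) else 0 := by
    obtain ⟨g, hg⟩ : ∃ g : End F (commutatorSpace F A), ∀ j, g (x j) = if j = i then w else 0 := by
      obtain ⟨g, hg⟩ := ((Finsupp.linearCombination F fun j ↦ if j = i then w else 0) ∘ₗ
        hx.repr).exists_extend
      refine ⟨g, fun j ↦ ?_⟩
      have := LinearMap.congr_fun hg ⟨x j, Submodule.subset_span ⟨j, rfl⟩⟩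
      simpa [hx.repr_eq_single j] using this
    obtain ⟨T, hT, hTx⟩ :=
      exists_mem_innerDerivationAlgebra_apply_eq_comp hF2 h1 (hSmem i) g (Finset.univ.image x)
    refine ⟨T, hT, fun j ↦ ?_⟩
    rw [hTx _ (by simp), hg]
    split_ifs <;> simp [hS]
  choose T hTmem hT using hT
  exact ⟨∑ i, T i, sum_mem fun i _ ↦ hTmem i, fun j ↦ by simp [hT]⟩
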